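/- Conventions. Let $d\in\mathbb N$, let $\mathcal J,\mathcal K$ be complex Hilbert spaces, and let $\mathbb B^d$ be the open Euclidean unit ball of $\mathbb C^d$. For $z,w\in\mathbb B^d$ put $zw^*=\sum_j z_j\overline{w_j}$; for a Hilbert space $\mathcal H$ let $z^*:\mathcal H\to\mathcal H\otimes\mathbb C^d$ be $z^*h=(\overline{z_1}h,\dots,\overline{z_d}h)$. Let $H^2_d\otimes\mathcal H$ be the reproducing kernel Hilbert space on $\mathbb B^d$ with kernel $(1-zw^*)^{-1}I_{\mathcal H}$. The Schur class $\mathscr S_d(\mathcal J,\mathcal K)$ consists of the functions $b:\mathbb B^d\to\mathscr L(\mathcal J,\mathcal K)$ that multiply $H^2_d\otimes\mathcal J$ into $H^2_d\otimes\mathcal K$ with multiplication operator of norm at most $1$. For such $b$, $\mathscr H(b)$ is the reproducing kernel Hilbert space of $\mathcal K$-valued functions on $\mathbb B^d$ with kernel $k^b(z,w)=(I-b(z)b(w)^*)/(1-zw^*)$, and $k^b_z:\mathcal K\to\mathscr H(b)$ is the adjoint of evaluation at $z$. The multiplier $b$ is purely contractive if $\|b(z)g\|<\|g\|$ for all $z\in\mathbb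 B^d$ and $0\ne g\in\mathcal J$, and $\mathrm{supp}(b)=\bigvee_{z\in\mathbb B^d}\mathrm{ran}\,b(z)^*$, where $\bigvee$ denotes closed linear span. A contractive Gleason solution for $b$ is a bounded operator $\mathbf b=(b_1,\dots,b_d)^T:\mathcal J\to\mathscr H(b)\otimes\mathbb C^d$ with $b(z)g-b(0)g=\sum_j z_j(b_jg)(z)$ for all $z\in\mathbb B^d$, $g\in\mathcal J$, and $\mathbf b^*\mathbf b\le I-b(0)^*b(0)$; it is extremal if equality holds in the last relation. The purely contractive multiplier $b$ is quasi-extreme if it has a unique contractive Gleason solution and this solution is extremal. A contractive Gleason solution for $\mathscr H(b)$ is a bounded operator $X=(X_1,\dots,X_d):\mathscr H(b)\otimes\mathbb C^d\to\mathscr H(b)$ with $\sum_j z_j(X_j^*f)(z)=f(z)-f(0)$ for all $f\in\mathscr H(b)$, $z\in\mathbb B^d$, and $XX^*\le I-k^b_0(k^b_0)^*$; it is extremal if equality holds in the last relation. Put $D_{X^*}=(I-XX^*)^{1/2}$. Theorem. Let $b\in\mathscr S_d(\mathcal J,\mathcal K)$ be purely contractive with $\mathrm{supp}(b)=\mathcal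 J$. Then $b$ is quasi-extreme if and only if there is an extremal contractive Gleason solution $X$ for $\mathscr H(b)$ such that $$\ker(X)^\perp\subseteq\bigvee_{z\in\mathbb B^d}z^*k^b_z\mathcal K=\bigvee_{z\in\mathbb B^d}z^*(I-Xz^*)^{-1}\,\mathrm{ran}\,D_{X^*}.$$ Moreover, the displayed equality of closed spans holds for every extremal contractive Gleason solution $X$ for $\mathscr H(b)$. -/

import Mathlib

open scoped InnerProductSpace ComplexOrder

noncomputable section

namespace GleasonModel

/-- The open unit ball of `ℂ^d` (Euclidean norm). -/
abbrev Ball (d : ℕ) : Type := Metric.ball (0 : EuclideanSpace ℂ (Fin d)) 1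

/-- The centre of the ball. -/
def Ball.zero (d : ℕ) : Ball d := ⟨0, Metric.mem_ball_self one_pos⟩

/-- The `j`-th coordinate of a point of the ball. -/
def Ball.coord {d : ℕ} (z : Ball d) (j : Fin d) : ℂ := (z : EuclideanSpace ℂ (Fin d)) j

/-- `z w^* = ∑ j, z_j * conj w_j`. -/
def Ball.pair {d : ℕ} (z w : Ball d) : ℂ :=
  ∑ j, z.coord j * (starRingEnd ℂ) (w.coord j)

section Szego

variable {d : ℕ} {V : Type*} [NormedAddCommGroup V] [InnerProductSpace ℂ V]

theorem Ball.pair_eq_inner (z w : Ball d) :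
    z.pair w = ⟪(w : EuclideanSpace ℂ (Fin d)), (z : EuclideanSpace ℂ (Fin d))⟫_ℂ := by
  simp [Ball.pair, Ball.coord, PiLp.inner_apply]

theorem Ball.norm_pair_lt_one (z w : Ball d) : ‖z.pair w‖ < 1 := by
  rw [Ball.pair_eq_inner]
  have hz : ‖(z : EuclideanSpace ℂ (Fin d))‖ < 1 := mem_ball_zero_iff.mp z.2
  have hw : ‖(w : EuclideanSpace ℂ (Fin d))‖ < 1 := mem_ball_zero_iff.mp w.2
  refine (norm_inner_le_norm _ _).trans_lt ?_
  exact mul_lt_one_of_nonneg_of_lt_one_left (norm_nonneg _) hw hz.le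

theorem Ball.conj_pair (z w : Ball d) : (starRingEnd ℂ) (z.pair w) = w.pair z := by
  rw [Ball.pair_eq_inner, Ball.pair_eq_inner, inner_conj_symm]

/-- The powers of `z w^*` are positive kernels. -/
theorem pow_pair_nonneg (n : ℕ) (v : Ball d →₀ V) :
    0 ≤ Complex.re (∑ x ∈ v.support, ∑ y ∈ v.support, (x.pair y) ^ n * ⟪v x, v y⟫_ℂ) := by
  have key : (∑ x ∈ v.support, ∑ y ∈ v.support, (x.pair y) ^ n * ⟪v x, v y⟫_ℂ)
      = ∑ p : Fin n → Fin d,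
        ⟪∑ x ∈ v.support, (∏ i, (starRingEnd ℂ) (x.coord (p i))) • v x,
          ∑ y ∈ v.support, (∏ i, (starRingEnd ℂ) (y.coord (p i))) • v y⟫_ℂ := by
    have hpow : ∀ x y : Ball d, (x.pair y) ^ n
        = ∑ p : Fin n → Fin d, (∏ i, x.coord (p i)) *
          ∏ i, (starRingEnd ℂ) (y.coord (p i)) := by
      intro x y
      rw [Ball.pair, ← Fin.prod_const, Finset.prod_univ_sum]
      simp [Finset.prod_mul_distrib]
    simp only [hpow, sum_inner, inner_sum, inner_smul_left, inner_smul_right, Finset.sum_mul,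
      map_prod, Complex.conj_conj]
    simp only [Finset.mul_sum]
    rw [Finset.sum_comm (s := Finset.univ), Finset.sum_comm]
    refine Finset.sum_congr rfl fun y _ => ?_
    rw [Finset.sum_comm (s := Finset.univ)]
    refine Finset.sum_congr rfl fun x _ => Finset.sum_congr rfl fun p _ => ?_
    ring
  rw [key, Complex.re_sum]
  exact Finset.sum_nonneg fun p _ => inner_self_nonneg (𝕜 := ℂ)

variable (d V) in
/-- The operator-valued Szegő kernel `k(z, w) = (1 - z w^*)⁻¹ I`. -/
def szegoKernel : Matrix (Ball d) (Ball d) (V →L[ℂ] V) :=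
  .of fun z w => (1 - z.pair w)⁻¹ • ContinuousLinearMap.id ℂ V

variable [CompleteSpace V]

theorem szegoKernel_posSemidef : (szegoKernel d V).PosSemidef := by
  have tfae := (RKHS.posSemidef_tfae (K := szegoKernel d V)).out 0 2
  refine tfae.mpr ⟨?_, fun v => ?_⟩
  · ext1 z w
    simp only [Matrix.conjTranspose_apply, szegoKernel, Matrix.of_apply, star_smul]
    have : star (ContinuousLinearMap.id ℂ V) = ContinuousLinearMap.id ℂ V :=
      star_one (V →L[ℂ] V)
    rw [this]
    simp [Ball.conj_pair]
  · have hlim : HasSum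
        (fun n : ℕ => Complex.re
          (∑ x ∈ v.support, ∑ y ∈ v.support, (x.pair y) ^ n * ⟪v x, v y⟫_ℂ))
        (Complex.re (∑ x ∈ v.support, ∑ y ∈ v.support, (1 - x.pair y)⁻¹ * ⟪v x, v y⟫_ℂ)) := by
      refine Complex.hasSum_re (hasSum_sum fun x _ => hasSum_sum fun y _ => ?_)
      exact (hasSum_geometric_of_norm_lt_one (Ball.norm_pair_lt_one x y)).mul_right _
    have h0 := hlim.nonneg fun n => pow_pair_nonneg n v
    have : (v.sum fun x w => v.sum fun x' w' => ⟪szegoKernel d V x' x w, w'⟫_ℂ)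
        = ∑ x ∈ v.support, ∑ y ∈ v.support, (1 - x.pair y)⁻¹ * ⟪v x, v y⟫_ℂ := by
      simp [Finsupp.sum, szegoKernel, Ball.conj_pair, mul_comm]
    rw [this]
    exact h0

instance : Fact (szegoKernel d V).PosSemidef := ⟨szegoKernel_posSemidef⟩

variable (d V) in
/-- The vector-valued Drury-Arveson space `H²_d ⊗ V`: the reproducing kernel Hilbert space of
the Szegő kernel. -/
abbrev DruryArveson : Type _ := RKHS.OfKernel (szegoKernel d V)

end Szego

section Schur

/-- The Schur class `S_d(J, K)`: the operator-valued functions on the ball that multiply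
`H²_d ⊗ J` into `H²_d ⊗ K`, with multiplication operator of norm at most one. -/
structure SchurClass (d : ℕ) (J K : Type*)
    [NormedAddCommGroup J] [InnerProductSpace ℂ J] [CompleteSpace J]
    [NormedAddCommGroup K] [InnerProductSpace ℂ K] [CompleteSpace K] where
  toFun : Ball d → J →L[ℂ] K
  contractive_multiplier : ∀ h : DruryArveson d J, ∃ f : DruryArveson d K,
    (∀ z, f z = toFun z (h z)) ∧ ‖f‖ ≤ ‖h‖

variable {d : ℕ} {J K : Type*}
  [NormedAddCommGroup J] [InnerProductSpace ℂ J] [CompleteSpace J]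
  [NormedAddCommGroup K] [InnerProductSpace ℂ K] [CompleteSpace K]

instance : CoeFun (SchurClass d J K) fun _ => Ball d → J →L[ℂ] K := ⟨SchurClass.toFun⟩

/-- `b` is purely contractive: each `b z` is a pure contraction. -/
def SchurClass.IsPurelyContractive (b : SchurClass d J K) : Prop :=
  ∀ z, ∀ g : J, g ≠ 0 → ‖b z g‖ < ‖g‖

/-- The support of `b`: the closed linear span of the ranges of the operators `(b z)^*`. -/
def SchurClass.support (b : SchurClass d J K) : Submodule ℂ J :=
  (⨆ z, (b z).adjoint.range).topologicalClosure

/-- The de Branges-Rovnyak kernel `(I - b(z) b(w)^*) / (1 - z w^*)`. -/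
def SchurClass.kernel (b : SchurClass d J K) : Matrix (Ball d) (Ball d) (K →L[ℂ] K) :=
  .of fun z w => (1 - z.pair w)⁻¹ • (ContinuousLinearMap.id ℂ K - b z ∘L (b w).adjoint)

theorem SchurClass.kernel_posSemidef (b : SchurClass d J K) : b.kernel.PosSemidef := by
  have tfae := (RKHS.posSemidef_tfae (K := b.kernel)).out 0 2
  refine tfae.mpr ⟨?_, fun v => ?_⟩
  · ext1 z w
    simp only [Matrix.conjTranspose_apply, SchurClass.kernel, Matrix.of_apply, star_smul]
    have h1 : star (ContinuousLinearMap.id ℂ K) = ContinuousLinearMap.id ℂ K :=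
      star_one (K →L[ℂ] K)
    rw [star_sub, h1, ContinuousLinearMap.star_eq_adjoint, ContinuousLinearMap.adjoint_comp]
    simp [Ball.conj_pair]
  · set F : DruryArveson d K :=
      ∑ x ∈ v.support, RKHS.kerFun (DruryArveson d K) x (v x) with hF
    set G : DruryArveson d J :=
      ∑ x ∈ v.support, RKHS.kerFun (DruryArveson d J) x ((b x).adjoint (v x)) with hG
    obtain ⟨f, hf, hfn⟩ := b.contractive_multiplier G
    have e1 : ⟪F, f⟫_ℂ = ⟪G, G⟫_ℂ := by
      conv_rhs => rw [hG, sum_inner]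
      rw [hF, sum_inner]
      refine Finset.sum_congr rfl fun x _ => ?_
      rw [RKHS.kerFun_inner, ← hG, RKHS.kerFun_inner, hf,
        ContinuousLinearMap.adjoint_inner_left]
    have e2 : ‖G‖ ≤ ‖F‖ := by
      have h : ‖G‖ * ‖G‖ ≤ ‖F‖ * ‖G‖ := by
        calc ‖G‖ * ‖G‖ = ‖⟪G, G⟫_ℂ‖ := by simp [inner_self_eq_norm_sq_to_K, sq]
          _ = ‖⟪F, f⟫_ℂ‖ := by rw [e1]
          _ ≤ ‖F‖ * ‖f‖ := norm_inner_le_norm _ _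
          _ ≤ ‖F‖ * ‖G‖ := by gcongr
      rcases (norm_nonneg G).eq_or_lt with h0 | h0
      · rw [← h0]; exact norm_nonneg _
      · exact le_of_mul_le_mul_right h h0
    have e3 : (v.sum fun x w => v.sum fun x' w' => ⟪b.kernel x' x w, w'⟫_ℂ)
        = ⟪F, F⟫_ℂ - ⟪G, G⟫_ℂ := by
      rw [hF, hG]
      simp only [Finsupp.sum, sum_inner, inner_sum, ← RKHS.kernel_inner,
        RKHS.OfKernel.kernel_ofKernel, ← Finset.sum_sub_distrib]
      conv_lhs => rw [Finset.sum_comm]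
      refine Finset.sum_congr rfl fun x _ => Finset.sum_congr rfl fun y _ => ?_
      simp [SchurClass.kernel, szegoKernel, inner_smul_left,
        ContinuousLinearMap.adjoint_inner_right]
      ring
    rw [e3, map_sub]
    have := mul_self_le_mul_self (norm_nonneg _) e2
    rw [← inner_self_eq_norm_mul_norm (𝕜 := ℂ), ← inner_self_eq_norm_mul_norm (𝕜 := ℂ)] at this
    exact sub_nonneg.mpr this

instance (b : SchurClass d J K) : Fact b.kernel.PosSemidef := ⟨b.kernel_posSemidef⟩

/-- The de Branges-Rovnyak space `H(b)`. -/
abbrev SchurClass.Space (b : SchurClass d J K) : Type _ := RKHS.OfKernel b.kernel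

/-- The kernel map `k_z^b : K → H(b)`, the adjoint of evaluation at `z`. -/
abbrev SchurClass.ker (b : SchurClass d J K) (z : Ball d) : K →L[ℂ] b.Space :=
  RKHS.kerFun b.Space z

end Schur

section Row

variable (d : ℕ) (H : Type*) [NormedAddCommGroup H] [InnerProductSpace ℂ H]

/-- The Hilbert space `H ⊗ ℂ^d`, that is, the Hilbert direct sum of `d` copies of `H`. -/
abbrev Copies : Type _ := PiLp 2 fun _ : Fin d => H

variable {d H}

/-- The operator `z^* : H → H ⊗ ℂ^d`, `h ↦ (conj z_1 h, …, conj z_d h)`. -/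
def zstar (z : Ball d) : H →L[ℂ] Copies d H :=
  (PiLp.continuousLinearEquiv 2 ℂ fun _ : Fin d => H).symm.toContinuousLinearMap ∘L
    ContinuousLinearMap.pi fun j => (starRingEnd ℂ) (z.coord j) • ContinuousLinearMap.id ℂ H

variable {E F : Type*} [NormedAddCommGroup E] [InnerProductSpace ℂ E] [CompleteSpace E]
  [NormedAddCommGroup F] [InnerProductSpace ℂ F] [CompleteSpace F]

/-- The defect operator `D_T = (I - T^* T)^{1/2}` of a contraction `T`. -/
def defect (T : E →L[ℂ] F) : E →L[ℂ] E :=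
  CFC.sqrt (ContinuousLinearMap.id ℂ E - T.adjoint ∘L T)

end Row

section Gleason

variable {d : ℕ} {J K : Type*}
  [NormedAddCommGroup J] [InnerProductSpace ℂ J] [CompleteSpace J]
  [NormedAddCommGroup K] [InnerProductSpace ℂ K] [CompleteSpace K]

/-- The row operator `X` solves the Gleason problem in `H(b)`:
`∑ j, z_j (X_j^* f)(z) = f(z) - f(0)`. -/
def SchurClass.IsGleasonForSpace (b : SchurClass d J K)
    (X : Copies d b.Space →L[ℂ] b.Space) : Prop :=
  ∀ (f : b.Space) (z : Ball d),
    ∑ j, z.coord j • (X.adjoint f j) z = f z - f (Ball.zero d)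

/-- `X` is a contractive Gleason solution for `H(b)`: `X X^* ≤ I - k_0 k_0^*`. -/
def SchurClass.IsContractiveGleasonForSpace (b : SchurClass d J K)
    (X : Copies d b.Space →L[ℂ] b.Space) : Prop :=
  b.IsGleasonForSpace X ∧
    X ∘L X.adjoint ≤
      ContinuousLinearMap.id ℂ b.Space - b.ker (Ball.zero d) ∘L (b.ker (Ball.zero d)).adjoint

/-- `X` is an extremal contractive Gleason solution for `H(b)`: equality holds. -/
def SchurClass.IsExtremalGleasonForSpace (b : SchurClass d J K)
    (X : Copies d b.Space →L[ℂ] b.Space) : Prop :=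
  b.IsContractiveGleasonForSpace X ∧
    X ∘L X.adjoint =
      ContinuousLinearMap.id ℂ b.Space - b.ker (Ball.zero d) ∘L (b.ker (Ball.zero d)).adjoint

/-- The operator `B : J → H(b) ⊗ ℂ^d` solves the Gleason problem for `b`:
`b(z) - b(0) = ∑ j, z_j B_j(z)`. -/
def SchurClass.IsGleason (b : SchurClass d J K) (B : J →L[ℂ] Copies d b.Space) : Prop :=
  ∀ (z : Ball d) (g : J), b z g - b (Ball.zero d) g = ∑ j, z.coord j • (B g j) z

/-- `B` is a contractive Gleason solution for `b`: `B^* B ≤ I - b(0)^* b(0)`. -/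
def SchurClass.IsContractiveGleason (b : SchurClass d J K)
    (B : J →L[ℂ] Copies d b.Space) : Prop :=
  b.IsGleason B ∧
    B.adjoint ∘L B ≤
      ContinuousLinearMap.id ℂ J - (b (Ball.zero d)).adjoint ∘L b (Ball.zero d)

/-- `B` is an extremal contractive Gleason solution for `b`: equality holds. -/
def SchurClass.IsExtremalGleason (b : SchurClass d J K)
    (B : J →L[ℂ] Copies d b.Space) : Prop :=
  b.IsContractiveGleason B ∧
    B.adjoint ∘L B =
      ContinuousLinearMap.id ℂ J - (b (Ball.zero d)).adjoint ∘L b (Ball.zero d)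

/-- `b` is quasi-extreme: it has a unique contractive Gleason solution, and this solution is
extremal. -/
def SchurClass.IsQuasiExtreme (b : SchurClass d J K) : Prop :=
  (∃! B : J →L[ℂ] Copies d b.Space, b.IsContractiveGleason B) ∧
    ∀ B : J →L[ℂ] Copies d b.Space, b.IsContractiveGleason B → b.IsExtremalGleason B

/-- The closed linear span of the subspaces `z^* k_z^b K`. -/
def SchurClass.kernelSpan (b : SchurClass d J K) : Submodule ℂ (Copies d b.Space) :=
  (⨆ z : Ball d, (zstar z ∘L b.ker z).range).topologicalClosure

/-- The closed linear span of the subspaces `z^* (I - X z^*)^{-1} ran D_{X^*}`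
of a row contraction `X`. -/
def defectSpan {H : Type*} [NormedAddCommGroup H] [InnerProductSpace ℂ H] [CompleteSpace H]
    (X : Copies d H →L[ℂ] H) : Submodule ℂ (Copies d H) :=
  (⨆ z : Ball d,
    (zstar z ∘L Ring.inverse (ContinuousLinearMap.id ℂ H - X ∘L zstar z) ∘L
      defect X.adjoint).range).topologicalClosure

end Gleason

end GleasonModel

end

/-! Clearing the denominator `1 - zw^*` in the kernel of `H(b)` shows that the families `(z^* k_z v,
v)` and `(k_z v, b(z)^* v)` have the same Gram matrix. Hence there is a partial isometry `V` from
`(H(b) ⊗ ℂ^d) ⊕ K` to `H(b) ⊕ J` carrying one to the other, and `ker V^*` consists of the pairs `(f,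
g)` with `f + b g = 0`. Its corners give Gleason solutions `X` for `H(b)` and `B` for `b`, with
`V^*(f, 0) = (X^* f, f(0))` and `V^*(0, g) = (B g, b(0) g)`. So `X` or `B` is extremal exactly when
`V^*` is isometric on the corresponding summand.

Both sides of the equivalence say that `V` is a coisometry, i.e. that `f + b g = 0` forces `f = 0`
and `g = 0`. A vector whose norm `V^*` preserves is orthogonal to `ker V^*`. Extremality of `B`
therefore gives `g = 0`, whence `f = 0`; extremality of `X` gives `f = 0`, whence `b g = 0`, and
full support gives `g = 0`. The condition on `ker(X)^⊥` identifies a given `X` with the corner of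
`V`.

The equality of spans is separate: it comes from `k_z = (I - X z^*)^{-1} k_0` and `D_{X^*}^2 = k_0
k_0^*`. -/

/-! ### Contractions, Gram matrices and defect identities in Hilbert space. -/

section Hilbert

variable {E F G : Type*} [NormedAddCommGroup E] [InnerProductSpace ℂ E]
  [NormedAddCommGroup F] [InnerProductSpace ℂ F]
  [NormedAddCommGroup G] [InnerProductSpace ℂ G]

namespace ContinuousLinearMap

theorem topologicalClosure_iSup_range_comp_le {ι : Type*} (A : ι → G →L[ℂ] E) {H : Type*}
    [NormedAddCommGroup H] [InnerProductSpace ℂ H] {P : H →L[ℂ] G} {Q : F →L[ℂ] G}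
    (h : P.range ≤ Q.range.topologicalClosure) :
    (⨆ i, (A i ∘L P).range).topologicalClosure ≤ (⨆ i, (A i ∘L Q).range).topologicalClosure := by
  refine Submodule.topologicalClosure_minimal _ (iSup_le fun i => ?_)
    (Submodule.isClosed_topologicalClosure _)
  rintro _ ⟨v, rfl⟩
  have h1 : P v ∈ closure (Q.range : Set G) := h ⟨v, rfl⟩
  refine map_mem_closure (f := A i) (A i).continuous h1 ?_
  rintro _ ⟨w, rfl⟩
  exact Submodule.mem_iSup_of_mem i ⟨w, rfl⟩

variable [CompleteSpace E] [CompleteSpace F]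

theorem norm_adjoint_apply_le {V : E →L[ℂ] F} (hV : ∀ x, ‖V x‖ ≤ ‖x‖) (y : F) :
    ‖V.adjoint y‖ ≤ ‖y‖ := by
  have h : ‖V.adjoint‖ ≤ 1 := by
    rw [LinearIsometryEquiv.norm_map]
    exact V.opNorm_le_bound zero_le_one fun x => by simpa using hV x
  simpa using V.adjoint.le_of_opNorm_le h y

/-- A contraction inverts its adjoint on vectors whose norm it preserves. -/
theorem adjoint_apply_apply_of_norm_eq {V : E →L[ℂ] F} (hV : ∀ x, ‖V x‖ ≤ ‖x‖) {x : E}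
    (hx : ‖V x‖ = ‖x‖) : V.adjoint (V x) = x := by
  have h1 : ‖V.adjoint (V x)‖ ≤ ‖x‖ := (norm_adjoint_apply_le hV _).trans_eq hx
  have h2 := norm_sub_sq (𝕜 := ℂ) (V.adjoint (V x)) x
  rw [adjoint_inner_left, inner_self_eq_norm_sq, hx] at h2
  have h3 : ‖V.adjoint (V x)‖ ^ 2 ≤ ‖x‖ ^ 2 := by gcongr
  have h4 : ‖V.adjoint (V x) - x‖ ^ 2 ≤ 0 := by linarith
  exact sub_eq_zero.mp (norm_eq_zero.mp (pow_eq_zero_iff two_ne_zero |>.mp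
    (le_antisymm h4 (sq_nonneg _))))

/-- Families of operators with the same Gram matrix are intertwined by a partial isometry. -/
theorem exists_partialIsometry_of_gram_eq {ι : Type*} (A : ι → G →L[ℂ] E) (S : ι → G →L[ℂ] F)
    (h : ∀ i j u v, ⟪S i u, S j v⟫_ℂ = ⟪A i u, A j v⟫_ℂ) :
    ∃ V : E →L[ℂ] F, (∀ x, ‖V x‖ ≤ ‖x‖) ∧ (∀ i v, V (A i v) = S i v) ∧
      (∀ x, (∀ i v, ⟪A i v, x⟫_ℂ = 0) → V x = 0) ∧
      (∀ i v, V.adjoint (S i v) = A i v) ∧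
      (∀ y, (∀ i v, ⟪S i v, y⟫_ℂ = 0) → V.adjoint y = 0) := by
  classical
  set a : (ι →₀ G) →ₗ[ℂ] E := Finsupp.lsum ℂ fun i => (A i).toLinearMap with ha
  set s : (ι →₀ G) →ₗ[ℂ] F := Finsupp.lsum ℂ fun i => (S i).toLinearMap with hs
  have hn : ∀ v, ‖s v‖ = ‖a v‖ := by
    intro v
    have : ⟪s v, s v⟫_ℂ = ⟪a v, a v⟫_ℂ := by
      simp only [ha, hs, Finsupp.lsum_apply, Finsupp.sum, sum_inner, inner_sum, coe_coe, h]
    rw [inner_self_eq_norm_sq_to_K, inner_self_eq_norm_sq_to_K] at this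
    have h2 : ‖s v‖ ^ 2 = ‖a v‖ ^ 2 := by exact_mod_cast this
    exact (sq_eq_sq₀ (norm_nonneg _) (norm_nonneg _)).mp h2
  -- Equal norms make `a v ↦ s v` well defined and isometric. Corestricting to the closure `R` of
  -- the range of `a` makes the domain dense; the extension to `R` is then precomposed with the
  -- projection onto `R`.
  set R : Submodule ℂ E := (LinearMap.range a).topologicalClosure with hR
  have : CompleteSpace R := (Submodule.isClosed_topologicalClosure _).completeSpace_coe
  set e : (ι →₀ G) →ₗ[ℂ] R := a.codRestrict R fun v =>
    Submodule.le_topologicalClosure _ ⟨v, rfl⟩ with he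
  have hd : DenseRange e := by
    intro x
    rw [closure_subtype]
    have hx : (x : E) ∈ closure (LinearMap.range a : Set E) := x.2
    refine closure_mono ?_ hx
    rintro _ ⟨v, rfl⟩
    exact ⟨e v, ⟨v, rfl⟩, rfl⟩
  have hb : ∀ v, ‖s v‖ ≤ 1 * ‖e v‖ := fun v => by
    rw [one_mul, hn v]; exact le_of_eq rfl
  -- The two claims on the adjoint are formal: a contraction is inverted by its adjoint where it
  -- preserves norms, and `V^* y` is orthogonal to itself once `y` is orthogonal to every `S i v`.
  suffices ∃ V : E →L[ℂ] F, (∀ x, ‖V x‖ ≤ ‖x‖) ∧ (∀ i v, V (A i v) = S i v) ∧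
      (∀ x, (∀ i v, ⟪A i v, x⟫_ℂ = 0) → V x = 0) by
    obtain ⟨V, h1, h2, h3⟩ := this
    refine ⟨V, h1, h2, h3, fun i v => ?_, fun y hy => ?_⟩
    · rw [← h2]
      refine adjoint_apply_apply_of_norm_eq h1 ?_
      rw [h2]
      have := h i i v v
      rw [inner_self_eq_norm_sq_to_K, inner_self_eq_norm_sq_to_K] at this
      have h4 : ‖S i v‖ ^ 2 = ‖A i v‖ ^ 2 := by exact_mod_cast this
      exact (sq_eq_sq₀ (norm_nonneg _) (norm_nonneg _)).mp h4
    · rw [← inner_self_eq_zero (𝕜 := ℂ), adjoint_inner_right, h3 _ fun i v => ?_,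
        inner_zero_left]
      rw [adjoint_inner_right, h2, hy]
  refine ⟨s.extendOfNorm e ∘L R.orthogonalProjectionOnto, fun x => ?_, fun i v => ?_, fun x hx => ?_⟩
  · refine (LinearMap.norm_extendOfNorm_apply_le hd 1 hb _).trans ?_
    rw [one_mul]
    exact Submodule.norm_orthogonalProjectionOnto_apply_le R x
  · have h1 : A i v = (e (Finsupp.single i v) : E) := by simp [he, ha]
    rw [comp_apply, h1, Submodule.orthogonalProjectionOnto_mem_subspace_eq_self,
      LinearMap.extendOfNorm_eq hd ⟨1, hb⟩]
    simp [hs]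
  · have h1 : x ∈ Rᗮ := by
      rw [hR, Submodule.orthogonal_closure, Submodule.mem_orthogonal]
      rintro _ ⟨v, rfl⟩
      simp [ha, Finsupp.sum, sum_inner, hx]
    rw [comp_apply, Submodule.orthogonalProjectionOnto_apply_of_mem_orthogonal h1,
      map_zero]

variable [CompleteSpace G]

theorem inner_apply_adjoint_apply (T : E →L[ℂ] G) (x : G) :
    ⟪T (T.adjoint x), x⟫_ℂ = ((‖T.adjoint x‖ ^ 2 : ℝ) : ℂ) := by
  rw [← adjoint_inner_right, inner_self_eq_norm_sq_to_K]
  norm_cast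

/-- Compares quadratic forms. It serves both Gleason problems: `T = X`, `S = k_0` and `T = B^*`, `S
= b(0)^*`. -/
theorem comp_adjoint_le_iff {T : E →L[ℂ] G} {S : F →L[ℂ] G} :
    T ∘L T.adjoint ≤ ContinuousLinearMap.id ℂ G - S ∘L S.adjoint ↔
      ∀ x, ‖T.adjoint x‖ ^ 2 + ‖S.adjoint x‖ ^ 2 ≤ ‖x‖ ^ 2 := by
  have key : ∀ x, (ContinuousLinearMap.id ℂ G - S ∘L S.adjoint - T ∘L T.adjoint).reApplyInnerSelf x
      = ‖x‖ ^ 2 - ‖S.adjoint x‖ ^ 2 - ‖T.adjoint x‖ ^ 2 := by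
    intro x
    simp only [reApplyInnerSelf_apply, sub_apply, coe_id', id_eq, comp_apply, inner_sub_left,
      map_sub, inner_self_eq_norm_sq, inner_apply_adjoint_apply, RCLike.re_to_complex,
      Complex.ofReal_re]
  rw [le_def, isPositive_def']
  constructor
  · intro h x
    have := h.2 x
    rw [key] at this
    linarith
  · intro h
    refine ⟨(((isPositive_id).isSelfAdjoint.sub
      (isPositive_self_comp_adjoint S).isSelfAdjoint).sub
      (isPositive_self_comp_adjoint T).isSelfAdjoint), fun x => ?_⟩
    rw [key]
    linarith [h x]

theorem comp_adjoint_eq_iff {T : E →L[ℂ] G} {S : F →L[ℂ] G} :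
    T ∘L T.adjoint = ContinuousLinearMap.id ℂ G - S ∘L S.adjoint ↔
      ∀ x, ‖T.adjoint x‖ ^ 2 + ‖S.adjoint x‖ ^ 2 = ‖x‖ ^ 2 := by
  constructor
  · intro h x
    have h1 := congrArg (fun A : G →L[ℂ] G => RCLike.re ⟪A x, x⟫_ℂ) h
    simp only [sub_apply, coe_id', id_eq, comp_apply, inner_sub_left,
      map_sub, inner_self_eq_norm_sq, inner_apply_adjoint_apply, RCLike.re_to_complex,
      Complex.ofReal_re] at h1
    linarith
  · intro h
    refine ContinuousLinearMap.coe_injective ((ext_inner_map _ _).mp fun x => ?_)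
    have h1 := congrArg (fun r : ℝ => (r : ℂ)) (h x)
    simp only [coe_coe, sub_apply, coe_id', id_eq, comp_apply, inner_sub_left,
      inner_apply_adjoint_apply, inner_self_eq_norm_sq_to_K]
    rw [eq_sub_iff_add_eq]
    simpa using h1

/-- `P P^*` determines the norms `‖P^* x‖`, hence `ker P^* = (ran P)^⊥`. -/
theorem topologicalClosure_range_eq_of_comp_adjoint_eq {P : E →L[ℂ] G} {Q : F →L[ℂ] G}
    (h : P ∘L P.adjoint = Q ∘L Q.adjoint) :
    P.range.topologicalClosure = Q.range.topologicalClosure := by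
  have hn : ∀ x, P.adjoint x = 0 ↔ Q.adjoint x = 0 := by
    intro x
    have h1 := congrArg (fun A : G →L[ℂ] G => ⟪A x, x⟫_ℂ) h
    simp only [comp_apply, inner_apply_adjoint_apply, Complex.ofReal_inj] at h1
    rw [← norm_eq_zero, ← norm_eq_zero (a := Q.adjoint x), ← sq_eq_zero_iff, h1, sq_eq_zero_iff]
  have hk : P.rangeᗮ = Q.rangeᗮ := by
    rw [orthogonal_range, orthogonal_range]
    ext x
    simpa using hn x
  rw [← Submodule.orthogonal_orthogonal_eq_closure, hk,
    Submodule.orthogonal_orthogonal_eq_closure]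

end ContinuousLinearMap

end Hilbert

namespace GleasonModel

open ContinuousLinearMap

/-! ### The operators `z^*`. -/

section Row

variable {d : ℕ} {H : Type*} [NormedAddCommGroup H] [InnerProductSpace ℂ H]

@[simp]
theorem zstar_apply (z : Ball d) (h : H) (j : Fin d) :
    zstar z h j = (starRingEnd ℂ) (z.coord j) • h := rfl

@[simp]
theorem zstar_zero (h : H) : zstar (Ball.zero d) h = 0 := by
  ext j
  simp [Ball.coord, Ball.zero]

theorem inner_zstar_left (z : Ball d) (h : H) (x : Copies d H) :
    ⟪zstar z h, x⟫_ℂ = ⟪h, ∑ j, z.coord j • x j⟫_ℂ := by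
  simp [PiLp.inner_apply, inner_smul_left]

theorem inner_zstar_zstar (z w : Ball d) (h k : H) :
    ⟪zstar z h, zstar w k⟫_ℂ = z.pair w * ⟪h, k⟫_ℂ := by
  simp [inner_zstar_left, Ball.pair, Finset.sum_mul, mul_assoc]

theorem norm_zstar_lt_one (z : Ball d) : ‖(zstar z : H →L[ℂ] Copies d H)‖ < 1 := by
  refine lt_of_le_of_lt (opNorm_le_bound _ (norm_nonneg (z : EuclideanSpace ℂ (Fin d)))
    fun h => ?_) (mem_ball_zero_iff.mp z.2)
  rw [← sq_le_sq₀ (norm_nonneg _) (by positivity), mul_pow, EuclideanSpace.norm_sq_eq,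
    PiLp.norm_sq_eq_of_L2, Finset.sum_mul]
  simp [Ball.coord, norm_smul, mul_pow]

theorem isUnit_id_sub_comp_zstar [CompleteSpace H] {X : Copies d H →L[ℂ] H} (hX : ‖X‖ ≤ 1)
    (z : Ball d) : IsUnit (ContinuousLinearMap.id ℂ H - X ∘L zstar z) := by
  have h : ‖X ∘L zstar z‖ < 1 :=
    calc ‖X ∘L zstar z‖ ≤ ‖X‖ * ‖(zstar z : H →L[ℂ] Copies d H)‖ := opNorm_comp_le _ _
      _ ≤ 1 * ‖(zstar z : H →L[ℂ] Copies d H)‖ := by gcongr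
      _ < 1 := by rw [one_mul]; exact norm_zstar_lt_one z
  exact (Units.oneSub _ h).isUnit

end Row

/-! ### Gleason solutions in terms of kernel vectors, and the equality of spans. -/

variable {d : ℕ} {J K : Type*}
  [NormedAddCommGroup J] [InnerProductSpace ℂ J] [CompleteSpace J]
  [NormedAddCommGroup K] [InnerProductSpace ℂ K] [CompleteSpace K]

namespace SchurClass

variable (b : SchurClass d J K)

theorem inner_ker_ker (z w : Ball d) (u v : K) :
    ⟪b.ker z u, b.ker w v⟫_ℂ =
      (1 - z.pair w)⁻¹ * (⟪u, v⟫_ℂ - ⟪(b z).adjoint u, (b w).adjoint v⟫_ℂ) := by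
  rw [RKHS.kerFun_inner, RKHS.kerFun_apply, RKHS.OfKernel.kernel_ofKernel]
  simp [SchurClass.kernel, inner_smul_right, inner_sub_right, adjoint_inner_left]

theorem inner_zstar_ker (z : Ball d) (v : K) (x : Copies d b.Space) :
    ⟪zstar z (b.ker z v), x⟫_ℂ = ⟪v, ∑ j, z.coord j • (x j) z⟫_ℂ := by
  simp [inner_zstar_left, RKHS.kerFun_inner]

theorem mem_orthogonal_kernelSpan {x : Copies d b.Space} :
    x ∈ b.kernelSpanᗮ ↔ ∀ z v, ⟪zstar z (b.ker z v), x⟫_ℂ = 0 := by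
  simp [kernelSpan, Submodule.orthogonal_closure, ← Submodule.iInf_orthogonal,
    Submodule.mem_iInf, Submodule.mem_orthogonal]

/-- The dual form of the Gleason identity: it prescribes `X` on the vectors spanning `b.kernelSpan`
and says nothing about the orthogonal complement. -/
theorem isGleasonForSpace_iff {X : Copies d b.Space →L[ℂ] b.Space} :
    b.IsGleasonForSpace X ↔
      ∀ z v, X (zstar z (b.ker z v)) = b.ker z v - b.ker (Ball.zero d) v := by
  have key : ∀ z v f, ⟪X (zstar z (b.ker z v)), f⟫_ℂ =
      ⟪v, ∑ j, z.coord j • (X.adjoint f j) z⟫_ℂ := fun z v f => by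
    rw [← adjoint_inner_right, inner_zstar_ker]
  constructor
  · intro h z v
    refine ext_inner_right ℂ fun f => ?_
    rw [key, h, inner_sub_left, inner_sub_right, RKHS.kerFun_inner, RKHS.kerFun_inner]
  · intro h f z
    refine ext_inner_left ℂ fun v => ?_
    rw [← key, h, inner_sub_left, inner_sub_right, RKHS.kerFun_inner, RKHS.kerFun_inner]

theorem isGleason_iff {B : J →L[ℂ] Copies d b.Space} :
    b.IsGleason B ↔
      ∀ z v, B.adjoint (zstar z (b.ker z v)) =
        (b z).adjoint v - (b (Ball.zero d)).adjoint v := by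
  have key : ∀ z v g, ⟪B.adjoint (zstar z (b.ker z v)), g⟫_ℂ =
      ⟪v, ∑ j, z.coord j • (B g j) z⟫_ℂ := fun z v f => by
    rw [adjoint_inner_left, inner_zstar_ker]
  constructor
  · intro h z v
    refine ext_inner_right ℂ fun g => ?_
    rw [key, ← h, inner_sub_left, inner_sub_right, adjoint_inner_left, adjoint_inner_left]
  · intro h z g
    refine ext_inner_left ℂ fun v => ?_
    rw [← key, h, inner_sub_left, inner_sub_right, adjoint_inner_left, adjoint_inner_left]

theorem isContractiveGleasonForSpace_iff {X : Copies d b.Space →L[ℂ] b.Space} :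
    b.IsContractiveGleasonForSpace X ↔ b.IsGleasonForSpace X ∧
      ∀ f, ‖X.adjoint f‖ ^ 2 + ‖f (Ball.zero d)‖ ^ 2 ≤ ‖f‖ ^ 2 := by
  rw [IsContractiveGleasonForSpace, comp_adjoint_le_iff]
  simp only [RKHS.adjoint_kerFun]

theorem isExtremalGleasonForSpace_iff {X : Copies d b.Space →L[ℂ] b.Space} :
    b.IsExtremalGleasonForSpace X ↔ b.IsGleasonForSpace X ∧
      ∀ f, ‖X.adjoint f‖ ^ 2 + ‖f (Ball.zero d)‖ ^ 2 = ‖f‖ ^ 2 := by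
  rw [IsExtremalGleasonForSpace, isContractiveGleasonForSpace_iff, comp_adjoint_eq_iff]
  simp only [RKHS.adjoint_kerFun]
  exact ⟨fun h => ⟨h.1.1, h.2⟩, fun h => ⟨⟨h.1, fun f => (h.2 f).le⟩, h.2⟩⟩

theorem isContractiveGleason_iff {B : J →L[ℂ] Copies d b.Space} :
    b.IsContractiveGleason B ↔ b.IsGleason B ∧
      ∀ g, ‖B g‖ ^ 2 + ‖b (Ball.zero d) g‖ ^ 2 ≤ ‖g‖ ^ 2 := by
  have := comp_adjoint_le_iff (T := B.adjoint) (S := (b (Ball.zero d)).adjoint)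
  simp only [adjoint_adjoint] at this
  rw [IsContractiveGleason, this]

theorem isExtremalGleason_iff {B : J →L[ℂ] Copies d b.Space} :
    b.IsExtremalGleason B ↔ b.IsGleason B ∧
      ∀ g, ‖B g‖ ^ 2 + ‖b (Ball.zero d) g‖ ^ 2 = ‖g‖ ^ 2 := by
  have := comp_adjoint_eq_iff (T := B.adjoint) (S := (b (Ball.zero d)).adjoint)
  simp only [adjoint_adjoint] at this
  rw [IsExtremalGleason, isContractiveGleason_iff, this]
  exact ⟨fun h => ⟨h.1.1, h.2⟩, fun h => ⟨⟨h.1, fun f => (h.2 f).le⟩, h.2⟩⟩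

variable {b}

/-- Extremality says `I - X X^* = k_0 k_0^*`, so `D_{X^*}` and `k_0` have the same closed range. The
Gleason identity reads `(I - X z^*) k_z = k_0`, and `I - X z^*` is invertible since `‖X‖ ≤ 1` and
`‖z^*‖ < 1`. -/
theorem IsExtremalGleasonForSpace.kernelSpan_eq {X : Copies d b.Space →L[ℂ] b.Space}
    (hX : b.IsExtremalGleasonForSpace X) : b.kernelSpan = defectSpan X := by
  set k₀ := b.ker (Ball.zero d) with hk₀
  have hn : ‖X‖ ≤ 1 := by
    rw [← LinearIsometryEquiv.norm_map adjoint X]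
    refine opNorm_le_bound _ zero_le_one fun f => ?_
    rw [one_mul, ← sq_le_sq₀ (norm_nonneg _) (norm_nonneg _)]
    linarith [(b.isExtremalGleasonForSpace_iff.mp hX).2 f, sq_nonneg ‖f (Ball.zero d)‖]
  have hD : ContinuousLinearMap.id ℂ b.Space - X.adjoint.adjoint ∘L X.adjoint =
      k₀ ∘L k₀.adjoint := by
    rw [adjoint_adjoint, hX.2, sub_sub_cancel]
  have hDD : defect X.adjoint ∘L (defect X.adjoint).adjoint = k₀ ∘L k₀.adjoint := by
    have hs : (defect X.adjoint).adjoint = defect X.adjoint :=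
      (CFC.sqrt_nonneg (ContinuousLinearMap.id ℂ b.Space -
        X.adjoint.adjoint ∘L X.adjoint)).isSelfAdjoint
    rw [hs]
    refine (CFC.sqrt_mul_sqrt_self _ ?_).trans hD
    rw [hD, nonneg_iff_isPositive]
    exact isPositive_self_comp_adjoint k₀
  have hr := topologicalClosure_range_eq_of_comp_adjoint_eq hDD
  have hk : ∀ z, zstar z ∘L b.ker z = (zstar z ∘L
      Ring.inverse (ContinuousLinearMap.id ℂ b.Space - X ∘L zstar z)) ∘L k₀ := by
    intro z
    have h1 : (ContinuousLinearMap.id ℂ b.Space - X ∘L zstar z) ∘L b.ker z = k₀ := by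
      ext1 v
      simp [b.isGleasonForSpace_iff.mp hX.1.1 z v, hk₀]
    have h2 := Ring.inverse_mul_cancel _ (isUnit_id_sub_comp_zstar hn z)
    rw [← h1]
    ext1 v
    exact congrArg (zstar z) (DFunLike.congr_fun h2 (b.ker z v)).symm
  simp only [kernelSpan, defectSpan, hk, ← comp_assoc]
  refine le_antisymm (topologicalClosure_iSup_range_comp_le _ ?_)
    (topologicalClosure_iSup_range_comp_le _ ?_)
  · rw [hr]; exact Submodule.le_topologicalClosure _
  · rw [← hr]; exact Submodule.le_topologicalClosure _

/-- `V` is the canonical colligation of `b`: the partial isometry with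
`(z^* k_z v, v) ↦ (k_z v, b(z)^* v)` that vanishes on the complement of these vectors. -/
structure IsColligation (b : SchurClass d J K)
    (V : WithLp 2 (Copies d b.Space × K) →L[ℂ] WithLp 2 (b.Space × J)) : Prop where
  norm_apply_le : ∀ x, ‖V x‖ ≤ ‖x‖
  apply_ker : ∀ z v, V (WithLp.toLp 2 (zstar z (b.ker z v), v)) =
    WithLp.toLp 2 (b.ker z v, (b z).adjoint v)
  apply_of_mem_orthogonal : ∀ x ∈ b.kernelSpanᗮ, V (WithLp.toLp 2 (x, 0)) = 0
  adjoint_apply_ker : ∀ z v, V.adjoint (WithLp.toLp 2 (b.ker z v, (b z).adjoint v)) =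
    WithLp.toLp 2 (zstar z (b.ker z v), v)
  adjoint_apply_eq_zero : ∀ (f : b.Space) (g : J), (∀ z, f z + b z g = 0) →
    V.adjoint (WithLp.toLp 2 (f, g)) = 0

theorem inner_toLp_ker (b : SchurClass d J K) (z : Ball d) (v : K) (f : b.Space) (g : J) :
    ⟪WithLp.toLp 2 (b.ker z v, (b z).adjoint v), WithLp.toLp 2 (f, g)⟫_ℂ =
      ⟪v, f z + b z g⟫_ℂ := by
  simp [WithLp.prod_inner_apply, RKHS.kerFun_inner, adjoint_inner_left]

/-- The Gram identity is `zw^* ⟪k_z u, k_w v⟫ + ⟪u, v⟫ = ⟪k_z u, k_w v⟫ + ⟪b(z)^* u, b(w)^* v⟫`,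
which is the definition of the kernel multiplied by `1 - zw^*`. -/
theorem exists_isColligation (b : SchurClass d J K) : ∃ V, b.IsColligation V := by
  obtain ⟨V, h1, h2, h3, h4, h5⟩ := exists_partialIsometry_of_gram_eq
    (fun z : Ball d =>
      (WithLp.prodContinuousLinearEquiv 2 ℂ (Copies d b.Space) K).symm.toContinuousLinearMap ∘L
        (zstar z ∘L b.ker z).prod (ContinuousLinearMap.id ℂ K))
    (fun z : Ball d =>
      (WithLp.prodContinuousLinearEquiv 2 ℂ b.Space J).symm.toContinuousLinearMap ∘L
        (b.ker z).prod (b z).adjoint) (fun z w u v => by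
        have hzw : (1 - z.pair w) ≠ 0 := by
          intro h
          have := Ball.norm_pair_lt_one z w
          rw [← sub_eq_zero.mp h, norm_one] at this
          exact lt_irrefl _ this
        simp only [comp_apply, ContinuousLinearEquiv.coe_coe, ContinuousLinearMap.prod_apply,
          WithLp.prodContinuousLinearEquiv_symm_apply,
          WithLp.prod_inner_apply, inner_zstar_zstar, inner_ker_ker, coe_id', id_eq]
        field_simp
        ring)
  refine ⟨V, h1, h2, fun x hx => h3 _ fun z v => ?_, h4, fun f g hfg => h5 _ fun z v => ?_⟩
  · simpa [WithLp.prod_inner_apply] using b.mem_orthogonal_kernelSpan.mp hx z v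
  · exact (b.inner_toLp_ker z v f g).trans (by rw [hfg, inner_zero_right])

/-- The corner `H(b) ⊗ ℂ^d → H(b)` of a colligation. -/
noncomputable def spaceCorner {b : SchurClass d J K}
    (V : WithLp 2 (Copies d b.Space × K) →L[ℂ] WithLp 2 (b.Space × J)) :
    Copies d b.Space →L[ℂ] b.Space :=
  WithLp.fstL 2 ℂ b.Space J ∘L V ∘L
    (WithLp.prodContinuousLinearEquiv 2 ℂ (Copies d b.Space) K).symm.toContinuousLinearMap ∘L
      ContinuousLinearMap.inl ℂ (Copies d b.Space) K

/-- The adjoint `J → H(b) ⊗ ℂ^d` of the corner `H(b) ⊗ ℂ^d → J` of a colligation. -/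
noncomputable def symbolCorner {b : SchurClass d J K}
    (V : WithLp 2 (Copies d b.Space × K) →L[ℂ] WithLp 2 (b.Space × J)) :
    J →L[ℂ] Copies d b.Space :=
  (WithLp.sndL 2 ℂ b.Space J ∘L V ∘L
    (WithLp.prodContinuousLinearEquiv 2 ℂ (Copies d b.Space) K).symm.toContinuousLinearMap ∘L
      ContinuousLinearMap.inl ℂ (Copies d b.Space) K).adjoint

variable {b : SchurClass d J K}
  {V : WithLp 2 (Copies d b.Space × K) →L[ℂ] WithLp 2 (b.Space × J)}

theorem spaceCorner_apply (x : Copies d b.Space) :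
    spaceCorner V x = (V (WithLp.toLp 2 (x, 0))).fst := rfl

theorem adjoint_symbolCorner_apply (x : Copies d b.Space) :
    (symbolCorner V).adjoint x = (V (WithLp.toLp 2 (x, 0))).snd := by
  rw [symbolCorner, adjoint_adjoint]
  rfl

/-! ### The corners of the colligation as Gleason solutions. -/

namespace IsColligation

variable (hV : b.IsColligation V)
include hV

/-- The case `z = 0`, where `z^* = 0`: all of `0 ⊕ K` lies in the initial space of `V`. -/
theorem apply_toLp_zero (v : K) : V (WithLp.toLp 2 (0, v)) =
    WithLp.toLp 2 (b.ker (Ball.zero d) v, (b (Ball.zero d)).adjoint v) := by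
  simpa using hV.apply_ker (Ball.zero d) v

theorem apply_toLp_zstar_ker (z : Ball d) (v : K) :
    V (WithLp.toLp 2 (zstar z (b.ker z v), 0)) =
      WithLp.toLp 2 (b.ker z v - b.ker (Ball.zero d) v,
        (b z).adjoint v - (b (Ball.zero d)).adjoint v) := by
  have h : WithLp.toLp 2 (zstar z (b.ker z v), (0 : K)) =
      WithLp.toLp 2 (zstar z (b.ker z v), v) - WithLp.toLp 2 (0, v) := by
    rw [← WithLp.toLp_sub]; simp
  rw [h, map_sub, hV.apply_ker, hV.apply_toLp_zero, ← WithLp.toLp_sub]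
  rfl

theorem adjoint_apply_toLp_fst (f : b.Space) :
    V.adjoint (WithLp.toLp 2 (f, 0)) =
      WithLp.toLp 2 ((spaceCorner V).adjoint f, f (Ball.zero d)) := by
  refine ext_inner_left ℂ ?_
  rintro ⟨x, v⟩
  have h : WithLp.toLp 2 (x, v) = WithLp.toLp 2 (x, 0) + WithLp.toLp 2 (0, v) := by
    rw [← WithLp.toLp_add]; simp
  rw [adjoint_inner_right, h, map_add, hV.apply_toLp_zero, inner_add_left, ← h]
  simp [WithLp.prod_inner_apply, adjoint_inner_right, spaceCorner_apply, RKHS.kerFun_inner]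

theorem adjoint_apply_toLp_snd (g : J) :
    V.adjoint (WithLp.toLp 2 (0, g)) =
      WithLp.toLp 2 (symbolCorner V g, b (Ball.zero d) g) := by
  refine ext_inner_left ℂ ?_
  rintro ⟨x, v⟩
  have h : WithLp.toLp 2 (x, v) = WithLp.toLp 2 (x, 0) + WithLp.toLp 2 (0, v) := by
    rw [← WithLp.toLp_add]; simp
  rw [adjoint_inner_right, h, map_add, hV.apply_toLp_zero, inner_add_left, ← h]
  simp [WithLp.prod_inner_apply, adjoint_inner_left, ← adjoint_inner_left (symbolCorner V),
    adjoint_symbolCorner_apply]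

theorem isGleasonForSpace : b.IsGleasonForSpace (spaceCorner V) :=
  b.isGleasonForSpace_iff.mpr fun z v => by
    simp [spaceCorner_apply, hV.apply_toLp_zstar_ker]

theorem isGleason : b.IsGleason (symbolCorner V) :=
  b.isGleason_iff.mpr fun z v => by
    simp [adjoint_symbolCorner_apply, hV.apply_toLp_zstar_ker]

theorem norm_adjoint_toLp_fst_sq (f : b.Space) :
    ‖V.adjoint (WithLp.toLp 2 (f, 0))‖ ^ 2 =
      ‖(spaceCorner V).adjoint f‖ ^ 2 + ‖f (Ball.zero d)‖ ^ 2 := by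
  simp [hV.adjoint_apply_toLp_fst, WithLp.prod_norm_sq_eq_of_L2]

theorem norm_adjoint_toLp_snd_sq (g : J) :
    ‖V.adjoint (WithLp.toLp 2 (0, g))‖ ^ 2 =
      ‖symbolCorner V g‖ ^ 2 + ‖b (Ball.zero d) g‖ ^ 2 := by
  simp [hV.adjoint_apply_toLp_snd, WithLp.prod_norm_sq_eq_of_L2]

theorem isContractiveGleason : b.IsContractiveGleason (symbolCorner V) := by
  refine b.isContractiveGleason_iff.mpr ⟨hV.isGleason, fun g => ?_⟩
  rw [← hV.norm_adjoint_toLp_snd_sq]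
  have := norm_adjoint_apply_le hV.norm_apply_le (WithLp.toLp 2 ((0 : b.Space), g))
  rw [WithLp.norm_toLp_snd] at this
  gcongr

theorem spaceCorner_apply_of_mem_orthogonal {x : Copies d b.Space} (hx : x ∈ b.kernelSpanᗮ) :
    spaceCorner V x = 0 := by
  rw [spaceCorner_apply, hV.apply_of_mem_orthogonal x hx]
  rfl

theorem adjoint_symbolCorner_apply_of_mem_orthogonal {x : Copies d b.Space}
    (hx : x ∈ b.kernelSpanᗮ) : (symbolCorner V).adjoint x = 0 := by
  rw [adjoint_symbolCorner_apply, hV.apply_of_mem_orthogonal x hx]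
  rfl

/-- A vector of `H(b) ⊕ J` whose norm is preserved by `V^*` is orthogonal to the orthogonal
complement of the range of `V`, which consists of the vectors `(f, g)` with `f + b g = 0`. -/
theorem inner_eq_zero_of_norm_adjoint_eq {f : b.Space} {g : J} (hfg : ∀ z, f z + b z g = 0)
    {y : WithLp 2 (b.Space × J)} (hy : ‖V.adjoint y‖ = ‖y‖) :
    ⟪WithLp.toLp 2 (f, g), y⟫_ℂ = 0 := by
  have h := adjoint_apply_apply_of_norm_eq (norm_adjoint_apply_le hV.norm_apply_le) hy
  rw [← h, adjoint_inner_right, hV.adjoint_apply_eq_zero f g hfg, inner_zero_left]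

/-- The component `y - V V^* y` is orthogonal to every `(k_z v, b(z)^* v)`, so it is a pair `(f, g)`
with `f + b g = 0`; the hypothesis then gives `V V^* = I`. -/
theorem norm_adjoint_apply_eq
    (h : ∀ (f : b.Space) (g : J), (∀ z, f z + b z g = 0) → f = 0 ∧ g = 0)
    (y : WithLp 2 (b.Space × J)) : ‖V.adjoint y‖ = ‖y‖ := by
  refine le_antisymm (norm_adjoint_apply_le hV.norm_apply_le y) ?_
  rcases hu : y - V (V.adjoint y) with ⟨f, g⟩
  have h0 := h f g fun z => ext_inner_left ℂ fun v => by
    rw [← b.inner_toLp_ker, ← hu, inner_sub_right, ← adjoint_inner_left V,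
      hV.adjoint_apply_ker, adjoint_inner_right, hV.apply_ker, sub_self, inner_zero_right]
  have h1 : y = V (V.adjoint y) := by
    rw [← sub_eq_zero, hu, h0.1, h0.2]
    rfl
  calc ‖y‖ = ‖V (V.adjoint y)‖ := congrArg norm h1
    _ ≤ ‖V.adjoint y‖ := hV.norm_apply_le _

end IsColligation

/-! ### Both conditions as the coisometry of the colligation. -/

variable {b : SchurClass d J K}

/-- The common kernel of the `b z` is the orthogonal complement of the support. -/
theorem eq_zero_of_forall_apply_eq_zero (hsupp : b.support = ⊤) {g : J}
    (hg : ∀ z, b z g = 0) : g = 0 := by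
  have h : g ∈ b.supportᗮ := by
    simp only [support, Submodule.orthogonal_closure, ← Submodule.iInf_orthogonal,
      Submodule.mem_iInf]
    intro z
    rw [Submodule.mem_orthogonal]
    rintro _ ⟨v, rfl⟩
    rw [coe_coe, adjoint_inner_left, hg, inner_zero_right]
  rwa [hsupp, Submodule.top_orthogonal_eq_bot, Submodule.mem_bot] at h

theorem IsQuasiExtreme.eq_zero_of_add_eq_zero (hb : b.IsQuasiExtreme) {f : b.Space} {g : J}
    (hfg : ∀ z, f z + b z g = 0) : f = 0 ∧ g = 0 := by
  obtain ⟨V, hV⟩ := b.exists_isColligation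
  have hB := (b.isExtremalGleason_iff.mp (hb.2 _ hV.isContractiveGleason)).2 g
  rw [← hV.norm_adjoint_toLp_snd_sq, sq_eq_sq₀ (norm_nonneg _) (norm_nonneg _),
    ← WithLp.norm_toLp_snd 2 b.Space J] at hB
  have hg : g = 0 := by
    simpa [WithLp.prod_inner_apply] using hV.inner_eq_zero_of_norm_adjoint_eq hfg hB
  subst hg
  exact ⟨RKHS.ext fun z => by simpa using hfg z, rfl⟩

theorem IsExtremalGleasonForSpace.eq_zero_of_add_eq_zero (hsupp : b.support = ⊤)
    {X : Copies d b.Space →L[ℂ] b.Space} (hX : b.IsExtremalGleasonForSpace X)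
    (hker : X.kerᗮ ≤ b.kernelSpan) {f : b.Space} {g : J}
    (hfg : ∀ z, f z + b z g = 0) : f = 0 ∧ g = 0 := by
  obtain ⟨V, hV⟩ := b.exists_isColligation
  rw [isExtremalGleasonForSpace_iff] at hX
  -- Both operators vanish on the complement of `b.kernelSpan`, for `X` by the kernel hypothesis,
  -- and the Gleason identity fixes both on `b.kernelSpan`.
  have hXV : X = spaceCorner V := by
    have hN : ∀ x ∈ b.kernelSpanᗮ, X x = 0 := fun x hx => by
      have h1 : x ∈ X.kerᗮᗮ := Submodule.orthogonal_le hker hx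
      have : CompleteSpace X.ker := X.isClosed_ker.completeSpace_coe
      rwa [Submodule.orthogonal_orthogonal] at h1
    have hM : ∀ x ∈ b.kernelSpan, X x = spaceCorner V x := by
      have hle : b.kernelSpan ≤ (X - spaceCorner V).ker := by
        refine Submodule.topologicalClosure_minimal _ (iSup_le fun z => ?_)
          (X - spaceCorner V).isClosed_ker
        rintro _ ⟨v, rfl⟩
        simp [b.isGleasonForSpace_iff.mp hX.1 z v,
          b.isGleasonForSpace_iff.mp hV.isGleasonForSpace z v]
      exact fun x hx => sub_eq_zero.mp (hle hx)
    have : CompleteSpace b.kernelSpan :=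
      (Submodule.isClosed_topologicalClosure _).completeSpace_coe
    ext1 x
    obtain ⟨y, hy, w, hw, rfl⟩ := b.kernelSpan.exists_add_mem_mem_orthogonal x
    rw [map_add, map_add, hM y hy, hN w hw, hV.spaceCorner_apply_of_mem_orthogonal hw]
  have hf := hX.2 f
  rw [hXV, ← hV.norm_adjoint_toLp_fst_sq, sq_eq_sq₀ (norm_nonneg _) (norm_nonneg _),
    ← WithLp.norm_toLp_fst 2 b.Space J] at hf
  have hf0 : f = 0 := by
    simpa [WithLp.prod_inner_apply] using hV.inner_eq_zero_of_norm_adjoint_eq hfg hf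
  subst hf0
  exact ⟨rfl, eq_zero_of_forall_apply_eq_zero hsupp fun z => by simpa using hfg z⟩

theorem isQuasiExtreme_of_eq_zero_of_add_eq_zero
    (h : ∀ (f : b.Space) (g : J), (∀ z, f z + b z g = 0) → f = 0 ∧ g = 0) :
    b.IsQuasiExtreme := by
  obtain ⟨V, hV⟩ := b.exists_isColligation
  set B₀ := symbolCorner V with hB₀
  have hE : ∀ g, ‖B₀ g‖ ^ 2 + ‖b (Ball.zero d) g‖ ^ 2 = ‖g‖ ^ 2 := fun g => by
    rw [hB₀, ← hV.norm_adjoint_toLp_snd_sq, hV.norm_adjoint_apply_eq h, WithLp.norm_toLp_snd]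
  have huniq : ∀ B, b.IsContractiveGleason B → B = B₀ := by
    intro B hB
    rw [isContractiveGleason_iff] at hB
    ext1 g
    -- The Gleason identity fixes the adjoint on `b.kernelSpan`, so two solutions differ by a vector
    -- orthogonal to it, whereas `B₀ g` lies in it.
    have hM : B g - B₀ g ∈ b.kernelSpanᗮ := by
      rw [b.mem_orthogonal_kernelSpan]
      intro z v
      rw [inner_sub_right, ← adjoint_inner_left B, ← adjoint_inner_left B₀,
        b.isGleason_iff.mp hB.1, b.isGleason_iff.mp hV.isGleason, sub_self]
    have h0 : ⟪B g - B₀ g, B₀ g⟫_ℂ = 0 := by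
      rw [← adjoint_inner_left, hV.adjoint_symbolCorner_apply_of_mem_orthogonal hM,
        inner_zero_left]
    have h1 : ‖B g‖ ^ 2 = ‖B g - B₀ g‖ ^ 2 + ‖B₀ g‖ ^ 2 := by
      have := norm_add_sq_eq_norm_sq_add_norm_sq_of_inner_eq_zero _ _ h0
      simpa [sq] using this
    -- Contractivity of `B` and extremality of `B₀` give `‖B g‖ ≤ ‖B₀ g‖`, leaving no room for the
    -- difference.
    have h2 : ‖B g - B₀ g‖ ^ 2 = 0 :=
      le_antisymm (by linarith [hB.2 g, hE g]) (sq_nonneg _)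
    exact sub_eq_zero.mp (norm_eq_zero.mp (pow_eq_zero_iff two_ne_zero |>.mp h2))
  refine ⟨⟨B₀, hV.isContractiveGleason, huniq⟩, fun B hB => ?_⟩
  rw [huniq B hB]
  exact b.isExtremalGleason_iff.mpr ⟨hV.isGleason, hE⟩

theorem exists_isExtremalGleasonForSpace_of_eq_zero_of_add_eq_zero
    (h : ∀ (f : b.Space) (g : J), (∀ z, f z + b z g = 0) → f = 0 ∧ g = 0) :
    ∃ X, b.IsExtremalGleasonForSpace X ∧ X.kerᗮ ≤ b.kernelSpan := by
  obtain ⟨V, hV⟩ := b.exists_isColligation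
  refine ⟨spaceCorner V, b.isExtremalGleasonForSpace_iff.mpr
    ⟨hV.isGleasonForSpace, fun f => ?_⟩, ?_⟩
  · rw [← hV.norm_adjoint_toLp_fst_sq, hV.norm_adjoint_apply_eq h, WithLp.norm_toLp_fst]
  · have hle : b.kernelSpanᗮ ≤ (spaceCorner V).ker := fun x hx =>
      hV.spaceCorner_apply_of_mem_orthogonal hx
    have : CompleteSpace b.kernelSpan :=
      (Submodule.isClosed_topologicalClosure _).completeSpace_coe
    calc (spaceCorner V).kerᗮ ≤ b.kernelSpanᗮᗮ := Submodule.orthogonal_le hle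
      _ = b.kernelSpan := Submodule.orthogonal_orthogonal _

end SchurClass

end GleasonModel

theorem mainTheorem10 (d : ℕ) (J K : Type*)
    [NormedAddCommGroup J] [InnerProductSpace ℂ J] [CompleteSpace J]
    [NormedAddCommGroup K] [InnerProductSpace ℂ K] [CompleteSpace K]
    (b : GleasonModel.SchurClass d J K)
    (hpure : b.IsPurelyContractive) (hsupp : b.support = ⊤) :
    (b.IsQuasiExtreme ↔
      ∃ X : GleasonModel.Copies d b.Space →L[ℂ] b.Space,
        b.IsExtremalGleasonForSpace X ∧
          X.kerᗮ ≤ b.kernelSpan ∧ b.kernelSpan = GleasonModel.defectSpan X) ∧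
    ∀ X : GleasonModel.Copies d b.Space →L[ℂ] b.Space,
      b.IsExtremalGleasonForSpace X → b.kernelSpan = GleasonModel.defectSpan X := by
  refine ⟨⟨fun hb => ?_, ?_⟩, fun X hX => hX.kernelSpan_eq⟩
  · obtain ⟨X, hX, hker⟩ :=
      GleasonModel.SchurClass.exists_isExtremalGleasonForSpace_of_eq_zero_of_add_eq_zero
        fun f g hfg => hb.eq_zero_of_add_eq_zero hfg
    exact ⟨X, hX, hker, hX.kernelSpan_eq⟩
  · rintro ⟨X, hX, hker, -⟩
    exact GleasonModel.SchurClass.isQuasiExtreme_of_eq_zero_of_add_eq_zero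
      fun f g hfg => hX.eq_zero_of_add_eq_zero hsupp hker hfg
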